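/- All Lie algebras are finite-dimensional over $\mathbb{C}$. For a Lie algebra $\mathfrak{l}$ and an $\mathfrak{l}$-module $M$, $H^1(\mathfrak{l},M)$ denotes the first Chevalley–Eilenberg cohomology, and $\mathfrak{l}$ is called complete if its center is zero and all its derivations are inner. **Proposition 3.8.** Let $\mathfrak{g}=\mathfrak{s}\ltimes\mathfrak{r}$ be a Levi decomposition of a Lie algebra $\mathfrak{g}$, that is, $\mathfrak{r}$ is the solvable radical of $\mathfrak{g}$ and $\mathfrak{s}$ is a semisimple subalgebra with $\mathfrak{g}=\mathfrak{s}\oplus\mathfrak{r}$ as vector spaces. Suppose that $\mathfrak{r}$ is nonzero and abelian. Then $H^1(\mathfrak{g},\mathfrak{g})\neq 0$, and $\mathfrak{g}$ is not complete. If moreover no direct summand of $\mathfrak{r}$ as an $\mathfrak{s}$-module is isomorphic, as an $\mathfrak{s}$-module, to a nonzero proper ideal of $\mathfrak{s}$, then there are isomorphisms of vector spaces $$H^1(\mathfrak{r},\mathfrak{r})^{\mathfrak{s}}\cong H^1(\mathfrak{r},\mathfrak{g})^{\mathfrak{s}}\cong H^1(\mathfrak{g},\mathfrak{g}),$$ where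 $(\cdot)^{\mathfrak{s}}$ denotes the $\mathfrak{s}$-invariants for the action of $\mathfrak{s}$ on $H^1(\mathfrak{r},M)$ induced by $(x\cdot f)(v)=x\cdot f(v)-f([x,v])$. -/

import Mathlib

namespace LieCoh

open LieModule.Cohomology

section Cohomology

variable (R : Type*) [CommRing R]
variable (L : Type*) [LieRing L] [LieAlgebra R L]
variable (M : Type*) [AddCommGroup M] [Module R M] [LieRingModule L M] [LieModule R L M]

/-- The Chevalley–Eilenberg coboundary from `0`-cochains to `1`-cochains,
`m ↦ (x ↦ ⁅x, m⁆)`. -/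
def d01 : M →ₗ[R] oneCochain R L M :=
  (LieModule.toEnd R L M : L →ₗ[R] Module.End R M).flip

/-- The `1`-cocycles: linear maps `f : L → M` with `⁅x, f y⁆ - ⁅y, f x⁆ - f ⁅x, y⁆ = 0`. -/
def oneCocycle : Submodule R (oneCochain R L M) := LinearMap.ker (d₁₂ R L M)

/-- The `1`-coboundaries: the maps `x ↦ ⁅x, m⁆` with `m` in `M`. -/
def oneCoboundary : Submodule R (oneCochain R L M) := LinearMap.range (d01 R L M)

/-- The first Chevalley–Eilenberg cohomology `H¹(L, M)`, cocycles modulo coboundaries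
(coboundaries are cocycles, see `oneCoboundary_le_oneCocycle`). -/
abbrev H1 := oneCocycle R L M ⧸ (oneCoboundary R L M).submoduleOf (oneCocycle R L M)

variable {R L M} in
lemma mem_oneCocycle_iff (f : L →ₗ[R] M) :
    f ∈ oneCocycle R L M ↔ ∀ x y, f ⁅x, y⁆ = ⁅x, f y⁆ - ⁅y, f x⁆ := by
  constructor
  · intro h x y
    have h' : d₁₂ R L M f = 0 := h
    have h2 : d₁₂ R L M f x y = 0 := by rw [h']; rfl
    rw [d₁₂_apply_apply] at h2
    exact (sub_eq_zero.mp h2).symm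
  · intro h
    change d₁₂ R L M f = 0
    apply Subtype.ext
    ext x y
    change ⁅x, f y⁆ - ⁅y, f x⁆ - f ⁅x, y⁆ = 0
    rw [h, sub_self]

variable {R L M} in
lemma mem_oneCoboundary_iff (f : L →ₗ[R] M) :
    f ∈ oneCoboundary R L M ↔ ∃ m : M, ∀ x, f x = ⁅x, m⁆ := by
  constructor
  · rintro ⟨m, rfl⟩
    exact ⟨m, fun x => rfl⟩
  · rintro ⟨m, hm⟩
    exact ⟨m, LinearMap.ext fun x => (hm x).symm⟩

lemma oneCoboundary_le_oneCocycle : oneCoboundary R L M ≤ oneCocycle R L M := by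
  intro f hf
  obtain ⟨m, hm⟩ := (mem_oneCoboundary_iff f).1 hf
  rw [mem_oneCocycle_iff]
  intro x y
  rw [hm, hm, hm, lie_lie]

end Cohomology

section Ideal

/-! For an ideal `I` of `L` and an `L`-module `M`, the Lie algebra `L` acts on the linear maps
`f : I → M` by `⁅x, f⁆ v = ⁅x, f v⁆ - f ⁅x, v⁆`.  This preserves cocycles and coboundaries, so
that `H¹(I, M)` is an `L`-module. -/

variable (R : Type*) [CommRing R]
variable {L : Type*} [LieRing L] [LieAlgebra R L]
variable (I : LieIdeal R L)
variable (M : Type*) [AddCommGroup M] [Module R M] [LieRingModule L M] [LieModule R L M]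

/-- The `1`-cocycles of an ideal `I` of `L` with values in an `L`-module, as an `L`-module. -/
def idealOneCocycle : LieSubmodule R L (I →ₗ[R] M) where
  __ := oneCocycle R I M
  lie_mem {x f} hf := by
    have hf' := (mem_oneCocycle_iff f).1 hf
    refine (mem_oneCocycle_iff (⁅x, f⁆ : I →ₗ[R] M)).2 fun u v => ?_
    have h1 : (⁅x, ⁅u, v⁆⁆ : I) = ⁅⁅x, u⁆, v⁆ + ⁅u, ⁅x, v⁆⁆ := by
      apply Subtype.ext
      exact leibniz_lie x (u : L) (v : L)
    have h2 : ∀ (w : I) (m : M), ⁅x, ⁅w, m⁆⁆ = ⁅(⁅x, w⁆ : I), m⁆ + ⁅w, ⁅x, m⁆⁆ := fun w m =>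
      leibniz_lie x (w : L) m
    simp only [LieHom.lie_apply, h1, map_add, hf', lie_sub, h2]
    abel

/-- The `1`-coboundaries, as an `L`-submodule of the `1`-cocycles. -/
def idealOneCoboundary : LieSubmodule R L (idealOneCocycle R I M) where
  __ := (oneCoboundary R I M).submoduleOf (oneCocycle R I M)
  lie_mem {x f} hf := by
    obtain ⟨m, hm⟩ := (mem_oneCoboundary_iff (f : I →ₗ[R] M)).1 hf
    refine (mem_oneCoboundary_iff (⁅x, (f : I →ₗ[R] M)⁆ : I →ₗ[R] M)).2 ⟨⁅x, m⁆, fun v => ?_⟩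
    rw [LieHom.lie_apply, hm, hm]
    change ⁅x, ⁅(v : L), m⁆⁆ - ⁅⁅x, (v : L)⁆, m⁆ = ⁅(v : L), ⁅x, m⁆⁆
    rw [leibniz_lie x (v : L) m, add_sub_cancel_left]

/-- `H¹(I, M)` for an ideal `I` of `L` and an `L`-module `M` (restricted to `I`). It is the same
vector space as `H1 R I M`, and as a quotient of Lie modules it carries the action of `L`. -/
abbrev idealH1 := idealOneCocycle R I M ⧸ idealOneCoboundary R I M

/-- The identification of the vector space underlying `idealH1` with `H1`. -/
def idealH1Equiv : idealH1 R I M ≃ₗ[R] H1 R I M := LinearEquiv.refl R (H1 R I M)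

/-- The space `H¹(I, M)^s` of invariants of a subalgebra `s` of `L` in `H¹(I, M)`. -/
abbrev idealH1Invariants (s : LieSubalgebra R L) : LieSubmodule R s (idealH1 R I M) :=
  LieModule.maxTrivSubmodule R s (idealH1 R I M)

end Ideal

/-- A Lie algebra is complete if its center is zero and all its derivations are inner. -/
def IsComplete (R L : Type*) [CommRing R] [LieRing L] [LieAlgebra R L] : Prop :=
  LieAlgebra.center R L = ⊥ ∧ ∀ D : LieDerivation R L L, ∃ x : L, D = LieDerivation.ad R L x

end LieCoh

/-!
# First cohomology of a Lie algebra with abelian radical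

Let `𝔤 = 𝔰 ⋉ 𝔯` with `𝔰` semisimple and `𝔯` abelian. All three cohomology spaces are identified with
the space `End_𝔰(𝔯)` of `𝔰`-module endomorphisms of `𝔯`.

The main tool is Whitehead's first lemma (`oneCocycle_le_oneCoboundary`): `H¹(𝔰, M) = 0`. For an
irreducible `M` with nonzero trace form, the Casimir operator of the ideal on which that form is
nondegenerate is invertible and provides an explicit primitive of a cocycle; if the trace form
vanishes, the action is trivial and `𝔰 = ⁅𝔰, 𝔰⁆` leaves no room for cocycles. The general case is
by induction on the dimension. It follows that an `𝔰`-invariant class in `H¹(𝔯, M)` has an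
`𝔰`-equivariant representative (`exists_equivariant_representative`), and that a cocycle of `𝔤` may be
taken to vanish on `𝔰`, so that it is `𝔰`-equivariant on `𝔯`.

Every `𝔰`-equivariant cocycle `f : 𝔯 → 𝔤` has values in `𝔯` (`equivariant_cocycle_mem`): the cocycle
identity on the abelian ideal `𝔯` makes the image of its `𝔰`-component an abelian ideal of `𝔰`. No
nonzero coboundary is `𝔰`-equivariant (`equivariant_coboundary_eq_zero`). Hence `End_𝔰(𝔯)` maps
isomorphically onto `H¹(𝔯, 𝔯)^𝔰`, `H¹(𝔯, 𝔤)^𝔰` and, through extension by zero on `𝔰`, `H¹(𝔤, 𝔤)`. The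
identity of `𝔯 ≠ 0` gives a nonzero class in `H¹(𝔤, 𝔤)`, that is, an outer derivation.
-/

namespace LieCoh

open Module LieModule

/-! ### Whitehead's first lemma -/

section Whitehead

variable {K L M : Type*} [Field K] [LieRing L] [LieAlgebra K L] [AddCommGroup M] [Module K M]

/-- An ideal `J` on which an invariant form is nondegenerate carries the canonical invariant tensor
`∑ i, e i ⊗ e' i`, with `e'` the basis dual to `e`. It is tested here against an arbitrary
bilinear map `φ`. -/
lemma sum_lie_dualBasis_eq_zero {ι : Type*} [Fintype ι] [DecidableEq ι]
    (J : LieIdeal K L) {B : LinearMap.BilinForm K J} (hB : B.Nondegenerate)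
    (hinv : ∀ (x : L) (a b : J), B ⁅x, a⁆ b = -B a ⁅x, b⁆)
    (e : Basis ι K J) (φ : J →ₗ[K] J →ₗ[K] M) (x : L) :
    ∑ i, (φ ⁅x, e i⁆ (B.dualBasis hB e i) + φ (e i) ⁅x, B.dualBasis hB e i⁆) = 0 := by
  set e' := B.dualBasis hB e with he'
  have h1 : ∀ a : J, a = ∑ j, B (e' j) a • e j := fun a => by
    conv_lhs => rw [← e.sum_repr a]
    refine Finset.sum_congr rfl fun j _ => ?_
    congr 1
    conv_rhs => rw [← e.sum_repr a]
    simp only [he', map_sum, map_smul, smul_eq_mul, LinearMap.BilinForm.apply_dualBasis_left,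
      mul_ite, mul_one, mul_zero, Finset.sum_ite_eq', Finset.mem_univ, if_true]
  have h2 : ∀ a : J, a = ∑ j, B a (e j) • e' j := fun a => by
    conv_lhs => rw [← e'.sum_repr a]
    refine Finset.sum_congr rfl fun j _ => ?_
    rw [he', LinearMap.BilinForm.dualBasis_repr_apply]
  have h3 : ∀ i, φ ⁅x, e i⁆ (e' i) = ∑ j, B (e' j) ⁅x, e i⁆ • φ (e j) (e' i) := fun i => by
    conv_lhs => rw [h1 ⁅x, e i⁆]
    simp
  have h4 : ∀ i, φ (e i) ⁅x, e' i⁆ = ∑ j, B ⁅x, e' i⁆ (e j) • φ (e i) (e' j) := fun i => by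
    conv_lhs => rw [h2 ⁅x, e' i⁆]
    simp
  rw [Finset.sum_add_distrib]
  simp_rw [h3, h4]
  rw [Finset.sum_comm, ← Finset.sum_add_distrib]
  refine Finset.sum_eq_zero fun i _ => ?_
  rw [← Finset.sum_add_distrib]
  refine Finset.sum_eq_zero fun j _ => ?_
  rw [hinv, ← add_smul, add_neg_eq_zero.mpr rfl, zero_smul]

variable [LieRingModule L M] [LieModule K L M]
variable [FiniteDimensional K L] [CharZero K] [LieAlgebra.HasTrivialRadical K L]

/-- A semisimple Lie algebra in characteristic zero is perfect: the Killing complement of its derived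
ideal is an abelian ideal. -/
lemma derivedSeries_one_eq_top : LieAlgebra.derivedSeries K L 1 = ⊤ := by
  set D := LieAlgebra.derivedSeries K L 1
  have hc := LieIdeal.isCompl_killingCompl D
  have hab : IsLieAbelian (LieIdeal.killingCompl K L D) := by
    refine ⟨fun x y => ?_⟩
    apply Subtype.ext
    have hmem : ⁅(x : L), (y : L)⁆ ∈ D ⊓ LieIdeal.killingCompl K L D :=
      ⟨LieSubmodule.lie_mem_lie (LieSubmodule.mem_top _) (LieSubmodule.mem_top _),
        lie_mem_right K L _ _ _ y.2⟩
    rw [hc.inf_eq_bot] at hmem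
    simpa using hmem
  have hbot : LieIdeal.killingCompl K L D = ⊥ :=
    (LieAlgebra.hasTrivialRadical_iff_no_abelian_ideals (R := K) (L := L)).1 inferInstance _ hab
  simpa [hbot] using hc.sup_eq_top

/-- If the trace form of an irreducible module vanishes, Cartan's criterion and Engel's theorem make
the action trivial; a `1`-cocycle then kills `⁅L, L⁆ = L`. -/
lemma cocycle_eq_zero_of_traceForm_eq_zero [FiniteDimensional K M] [IsIrreducible K L M]
    (h : traceForm K L M = 0) {f : L →ₗ[K] M} (hf : f ∈ oneCocycle K L M) : f = 0 := by
  have hnil : LieModule.IsNilpotent L M := by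
    have h1 := isNilpotent_derivedSeries_of_traceForm_eq_zero h
    rw [isNilpotent_iff_forall' (R := K)] at h1 ⊢
    intro x
    exact h1 ⟨x, by rw [derivedSeries_one_eq_top]; exact LieSubmodule.mem_top x⟩
  have : Nontrivial M := nontrivial_of_isIrreducible K L M
  have : Nontrivial (maxTrivSubmodule K L M) := nontrivial_max_triv_of_isNilpotent K L M
  have htop := LieSubmodule.eq_top_of_isIrreducible K L M (maxTrivSubmodule K L M)
  have htriv : ∀ (x : L) (m : M), ⁅x, m⁆ = 0 := fun x m =>
    (mem_maxTrivSubmodule K L M m).1 (htop ▸ LieSubmodule.mem_top m) x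
  ext x
  have hx : x ∈ (LieAlgebra.derivedSeries K L 1 : LieIdeal K L) := by
    rw [derivedSeries_one_eq_top]; exact LieSubmodule.mem_top x
  have hx' : x ∈ Submodule.span K {m | ∃ a b : L, ⁅a, b⁆ = m} := by
    rw [← LieSubmodule.mem_toSubmodule] at hx
    change x ∈ (⁅(⊤ : LieIdeal K L), (⊤ : LieIdeal K L)⁆ : LieIdeal K L).toSubmodule at hx
    rw [LieSubmodule.lieIdeal_oper_eq_linear_span'] at hx
    simpa using hx
  clear hx
  induction hx' using Submodule.span_induction with
  | mem x h =>
    obtain ⟨a, b, rfl⟩ := h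
    simp [(mem_oneCocycle_iff f).1 hf a b, htriv]
  | zero => simp
  | add x y _ _ h1 h2 => simp_all
  | smul c x _ h1 => simp_all

/-- **Whitehead's first lemma** for an irreducible module. -/
lemma oneCocycle_le_oneCoboundary_of_isIrreducible [FiniteDimensional K M] [IsIrreducible K L M] :
    oneCocycle K L M ≤ oneCoboundary K L M := by
  intro f hf
  by_cases h0 : traceForm K L M = 0
  · rw [cocycle_eq_zero_of_traceForm_eq_zero h0 hf]
    exact Submodule.zero_mem _
  -- The radical `I` of the trace form is an ideal, and the form is nondegenerate on its Killing
  -- complement `J`.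
  let I : LieIdeal K L :=
    { LinearMap.ker (traceForm K L M) with
      lie_mem := fun {x m} hm => by
        have hm' : traceForm K L M m = 0 := hm
        change traceForm K L M ⁅x, m⁆ = 0
        ext y
        rw [traceForm_apply_lie_apply', hm']
        simp }
  have memI : ∀ x, x ∈ I ↔ ∀ y, traceForm K L M x y = 0 := fun x => by
    change traceForm K L M x = 0 ↔ _
    exact ⟨fun h y => by rw [h]; rfl, fun h => LinearMap.ext h⟩
  let J := LieIdeal.killingCompl K L I
  have hc : IsCompl I J := LieIdeal.isCompl_killingCompl I
  let B : LinearMap.BilinForm K J := (traceForm K L M).restrict J.toSubmodule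
  have hBa : ∀ a b : J, B a b = traceForm K L M a b := fun _ _ => rfl
  have hsymm : B.IsSymm := ⟨fun a b => traceForm_comm K L M a b⟩
  have hinv : ∀ (x : L) (a b : J), B ⁅x, a⁆ b = -B a ⁅x, b⁆ := fun x a b =>
    traceForm_apply_lie_apply' K L M x a b
  have hB : B.Nondegenerate := by
    refine hsymm.isRefl.nondegenerate_iff_separatingLeft.2 ?_
    intro a ha
    -- `a` is orthogonal to `J` by assumption and to `I` in any case.
    have haI : (a : L) ∈ I := by
      refine (memI _).2 fun y => ?_
      obtain ⟨u, hu, v, hv, rfl⟩ := (LieSubmodule.mem_sup I J y).1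
        (hc.sup_eq_top ▸ LieSubmodule.mem_top y : y ∈ I ⊔ J)
      rw [map_add, traceForm_comm, (memI u).1 hu, zero_add]
      exact ha ⟨v, hv⟩
    have ha0 : (a : L) ∈ I ⊓ J := ⟨haI, a.2⟩
    rw [hc.inf_eq_bot] at ha0
    exact Subtype.ext ((LieSubmodule.mem_bot _).1 ha0)
  have hJ : J ≠ ⊥ := by
    intro hJ
    apply h0
    have hI : I = ⊤ := by simpa [hJ] using hc.sup_eq_top
    ext x y
    exact (memI x).1 (hI ▸ LieSubmodule.mem_top x) y
  let e := Module.finBasis K J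
  let e' := B.dualBasis hB e
  -- The Casimir operator commutes with the action, and its trace is `dim J ≠ 0`.
  let C : End K M := ∑ i, toEnd K L M (e i) * toEnd K L M (e' i)
  have hCa : ∀ m, C m = ∑ i, ⁅(e i : L), ⁅(e' i : L), m⁆⁆ := fun m => by
    simp [C]
  have hCcomm : ∀ (x : L) (m : M), C ⁅x, m⁆ = ⁅x, C m⁆ := fun x m => by
    let φ : J →ₗ[K] J →ₗ[K] M := LinearMap.mk₂ K (fun a b => ⁅(a : L), ⁅(b : L), m⁆⁆)
      (by simp) (by simp) (by simp) (by simp)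
    have h := sum_lie_dualBasis_eq_zero J hB hinv e φ x
    simp only [φ, LinearMap.mk₂_apply, LieSubmodule.coe_bracket] at h
    rw [hCa, hCa, lie_sum, eq_comm, ← sub_eq_zero, ← Finset.sum_sub_distrib, ← h]
    refine Finset.sum_congr rfl fun i _ => ?_
    simp only [lie_lie, lie_sub, e']
    abel
  have hCtr : LinearMap.trace K M C = finrank K J := by
    have : ∀ i, LinearMap.trace K M (toEnd K L M (e i) * toEnd K L M (e' i)) = 1 := fun i => by
      have := LinearMap.BilinForm.apply_dualBasis_right hB hsymm e i i
      rw [if_pos rfl, hBa] at this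
      exact this
    simp [C, this]
  -- By irreducibility the Casimir operator is injective.
  let N : LieSubmodule K L M :=
    { LinearMap.ker C with
      lie_mem := fun {x m} hm => by
        have hm' : C m = 0 := hm
        change C ⁅x, m⁆ = 0
        rw [hCcomm, hm', lie_zero] }
  have hN : N = ⊥ := by
    refine (IsSimpleOrder.eq_bot_or_eq_top N).resolve_right fun hN => hJ ?_
    have hC0 : C = 0 := by
      ext m
      have : m ∈ N := hN ▸ LieSubmodule.mem_top m
      exact this
    rw [hC0, map_zero, eq_comm, Nat.cast_eq_zero, finrank_eq_zero_iff_of_free] at hCtr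
    exact (LieSubmodule.eq_bot_iff J).2 fun x hx =>
      congrArg Subtype.val (Subsingleton.elim (⟨x, hx⟩ : J) 0)
  have hinj : Function.Injective C := by
    rw [← LinearMap.ker_eq_bot]
    exact congrArg LieSubmodule.toSubmodule hN
  obtain ⟨m, hm⟩ := (LinearMap.injective_iff_surjective.1 hinj) (∑ i, ⁅(e i : L), f (e' i)⁆)
  refine (mem_oneCoboundary_iff f).2 ⟨m, fun x => hinj ?_⟩
  let φ : J →ₗ[K] J →ₗ[K] M := LinearMap.mk₂ K (fun a b => ⁅(a : L), f b⁆)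
    (by simp) (by simp) (by simp) (by simp)
  have h := sum_lie_dualBasis_eq_zero J hB hinv e φ x
  simp only [φ, LinearMap.mk₂_apply, LieSubmodule.coe_bracket] at h
  rw [hCcomm, hm, hCa, lie_sum, eq_comm, ← sub_eq_zero, ← Finset.sum_sub_distrib, ← h]
  refine Finset.sum_congr rfl fun i _ => ?_
  rw [(mem_oneCocycle_iff f).1 hf x, lie_sub, lie_lie]
  simp only [e']
  abel

/-- **Whitehead's first lemma**: `H¹(L, M) = 0` for `L` semisimple over a field of
characteristic zero. -/
theorem oneCocycle_le_oneCoboundary [FiniteDimensional K M] :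
    oneCocycle K L M ≤ oneCoboundary K L M := by
  induction hn : finrank K M using Nat.strong_induction_on generalizing M with
  | _ n ih =>
  subst hn
  rcases subsingleton_or_nontrivial M with hM | hM
  · intro f _
    rw [show f = 0 from Subsingleton.elim _ _]
    exact Submodule.zero_mem _
  by_cases hirr : IsIrreducible K L M
  · exact oneCocycle_le_oneCoboundary_of_isIrreducible
  obtain ⟨N, hN0, hN1⟩ : ∃ N : LieSubmodule K L M, N ≠ ⊥ ∧ N ≠ ⊤ := by
    by_contra! h
    exact hirr (IsIrreducible.mk h)
  intro f hf
  have hf' := (mem_oneCocycle_iff f).1 hf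
  -- Modulo `N` the cocycle is a coboundary; the corrected cocycle has values in `N`.
  have hq : finrank K (M ⧸ N) < finrank K M := by
    have h1 := Submodule.finrank_quotient_add_finrank N.toSubmodule
    have h2 : finrank K N ≠ 0 := fun h => hN0 <| by
      rw [finrank_eq_zero_iff_of_free] at h
      exact (LieSubmodule.eq_bot_iff N).2 fun x hx =>
        congrArg Subtype.val (Subsingleton.elim (⟨x, hx⟩ : N) 0)
    change finrank K (M ⧸ N) + finrank K N = finrank K M at h1
    omega
  have hs : finrank K N < finrank K M := by
    refine Submodule.finrank_lt ?_
    simpa using hN1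
  let π := LieSubmodule.Quotient.mk' N
  obtain ⟨q, hq'⟩ := (mem_oneCoboundary_iff _).1 <| ih _ hq rfl
    ((mem_oneCocycle_iff ((π : M →ₗ[K] M ⧸ N) ∘ₗ f)).2 fun x y => by simp [hf'])
  obtain ⟨m, rfl⟩ := LieSubmodule.Quotient.surjective_mk' N q
  have hmem : ∀ x, f x - ⁅x, m⁆ ∈ N := fun x => by
    rw [← LieSubmodule.Quotient.mk_eq_zero']
    change π (f x - ⁅x, m⁆) = 0
    rw [map_sub, sub_eq_zero, LieModuleHom.map_lie]
    exact hq' x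
  let g : L →ₗ[K] N := LinearMap.codRestrict N.toSubmodule (f - d01 K L M m) hmem
  have hg : ∀ x, (g x : M) = f x - ⁅x, m⁆ := fun _ => rfl
  obtain ⟨n, hn⟩ := (mem_oneCoboundary_iff _).1 <| ih _ hs rfl
    ((mem_oneCocycle_iff g).2 fun x y => by
      apply Subtype.ext
      simp only [hg, LieSubmodule.coe_sub, LieSubmodule.coe_bracket, hf', lie_sub, lie_lie]
      abel)
  refine (mem_oneCoboundary_iff f).2 ⟨n + m, fun x => ?_⟩
  have := hg x
  rw [hn, LieSubmodule.coe_bracket] at this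
  rw [lie_add, this, sub_add_cancel]

/-- Taking invariants under a semisimple Lie algebra is exact: an invariant class of `M ⧸ N` has an
invariant representative. -/
lemma exists_mem_forall_lie_sub_eq_zero [FiniteDimensional K M] (N : LieSubmodule K L M) (m : M)
    (h : ∀ x : L, ⁅x, m⁆ ∈ N) : ∃ n ∈ N, ∀ x : L, ⁅x, m - n⁆ = 0 := by
  let g : L →ₗ[K] N := LinearMap.codRestrict N.toSubmodule (d01 K L M m) h
  have hg : ∀ x, (g x : M) = ⁅x, m⁆ := fun _ => rfl
  obtain ⟨n, hn⟩ := (mem_oneCoboundary_iff _).1 <| oneCocycle_le_oneCoboundary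
    ((mem_oneCocycle_iff g).2 fun x y => by
      apply Subtype.ext
      simp only [hg, LieSubmodule.coe_sub, LieSubmodule.coe_bracket, lie_lie])
  refine ⟨n, n.2, fun x => ?_⟩
  rw [lie_sub, ← LieSubmodule.coe_bracket, ← hn, hg, sub_self]

end Whitehead

/-! ### Cohomology of a semidirect product with an abelian ideal -/

section LeviDecomposition

variable {K 𝔤 : Type*} [Field K] [LieRing 𝔤] [LieAlgebra K 𝔤]
variable {𝔰 : LieSubalgebra K 𝔤} {𝔯 : LieIdeal K 𝔤}

section Invariants

variable [CharZero K] [FiniteDimensional K 𝔰] [LieAlgebra.HasTrivialRadical K 𝔰]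
variable [FiniteDimensional K 𝔯]
variable {M : Type*} [AddCommGroup M] [Module K M] [LieRingModule 𝔤 M] [LieModule K 𝔤 M]
variable [FiniteDimensional K M]

/-- An `𝔰`-invariant class in `H¹(𝔯, M)` is represented by an `𝔰`-equivariant cocycle, since
`H¹(𝔰, ·)` vanishes on the space of coboundaries. -/
lemma exists_equivariant_representative (c : idealH1Invariants K 𝔯 M 𝔰) :
    ∃ f : idealOneCocycle K 𝔯 M, LieSubmodule.Quotient.mk f = c.1 ∧
      ∀ (x : 𝔰) (v : 𝔯), f.1 ⁅x, v⁆ = ⁅x, f.1 v⁆ := by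
  obtain ⟨c, hc⟩ := c
  obtain ⟨f, rfl⟩ := LieSubmodule.Quotient.surjective_mk' _ c
  let N : LieSubmodule K 𝔰 (idealOneCocycle K 𝔯 M) :=
    { (idealOneCoboundary K 𝔯 M).toSubmodule with
      lie_mem := fun {x m} hm => (idealOneCoboundary K 𝔯 M).lie_mem (x := (x : 𝔤)) hm }
  have : FiniteDimensional K (idealOneCocycle K 𝔯 M) :=
    inferInstanceAs (FiniteDimensional K (idealOneCocycle K 𝔯 M).toSubmodule)
  obtain ⟨n, hn, h⟩ := exists_mem_forall_lie_sub_eq_zero N f fun x =>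
    LieSubmodule.Quotient.mk_eq_zero'.1 ((mem_maxTrivSubmodule K 𝔰 _ _).1 hc x)
  refine ⟨f - n, ?_, fun x v => ?_⟩
  · refine (Submodule.Quotient.eq _).2 ?_
    rw [sub_sub_cancel_left]
    exact neg_mem hn
  · have h1 := LinearMap.congr_fun (congrArg Subtype.val (h x)) v
    exact (sub_eq_zero.1 h1).symm

/-- For an abelian ideal `𝔯` and an embedding `ι : 𝔯 → M` through which every `𝔰`-equivariant cocycle
`𝔯 → M` factors, `φ ↦ ι ∘ φ` identifies `End_𝔰(𝔯)` with `H¹(𝔯, M)^𝔰`, provided that no nonzero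
coboundary is `𝔰`-equivariant. -/
lemma nonempty_equiv_idealH1Invariants [IsLieAbelian 𝔯]
    (ι : 𝔯 →ₗ⁅K,𝔤⁆ M) (hι : Function.Injective ι)
    (hfactor : ∀ f ∈ oneCocycle K 𝔯 M, (∀ (x : 𝔰) (v : 𝔯), f ⁅x, v⁆ = ⁅x, f v⁆) →
      ∃ φ : 𝔯 →ₗ⁅K,𝔰⁆ 𝔯, ∀ v, f v = ι (φ v))
    (hcobound : ∀ m : M, (∀ (x : 𝔰) (v : 𝔯), ⁅(⁅x, v⁆ : 𝔯), m⁆ = ⁅x, ⁅v, m⁆⁆) →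
      ∀ v : 𝔯, ⁅v, m⁆ = 0) :
    Nonempty ((𝔯 →ₗ⁅K,𝔰⁆ 𝔯) ≃ₗ[K] idealH1Invariants K 𝔯 M 𝔰) := by
  have hzero : ∀ u v : 𝔯, ⁅u, ι v⁆ = 0 := fun u v => by
    have h1 : ⁅(u : 𝔤), v⁆ = 0 := trivial_lie_zero 𝔯 𝔯 u v
    change ⁅(u : 𝔤), ι v⁆ = 0
    rw [← LieModuleHom.map_lie, h1, map_zero]
  let F : (𝔯 →ₗ⁅K,𝔰⁆ 𝔯) →ₗ[K] idealOneCocycle K 𝔯 M :=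
    { toFun := fun φ => ⟨(ι : 𝔯 →ₗ[K] M) ∘ₗ (φ : 𝔯 →ₗ[K] 𝔯), (mem_oneCocycle_iff _).2 fun u v => by
        simp [hzero, trivial_lie_zero 𝔯 𝔯 u v]⟩
      map_add' := fun φ ψ => by
        apply Subtype.ext
        ext v
        exact map_add ι _ _
      map_smul' := fun c φ => by
        apply Subtype.ext
        ext v
        exact map_smul ι _ _ }
  have hF : ∀ φ v, (F φ).1 v = ι (φ v) := fun _ _ => rfl
  let G : (𝔯 →ₗ⁅K,𝔰⁆ 𝔯) →ₗ[K] idealH1Invariants K 𝔯 M 𝔰 :=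
    LinearMap.codRestrict (idealH1Invariants K 𝔯 M 𝔰).toSubmodule
      ((idealOneCoboundary K 𝔯 M).toSubmodule.mkQ ∘ₗ F) fun φ => by
        refine (mem_maxTrivSubmodule K 𝔰 _ _).2 fun x => ?_
        have h0 : ⁅(x : 𝔤), F φ⁆ = 0 := by
          apply Subtype.ext
          ext v
          change ⁅(x : 𝔤), ι (φ v)⁆ - ι (φ ⁅x, v⁆) = 0
          rw [LieModuleHom.map_lie, ← LieModuleHom.map_lie, sub_eq_zero]
          rfl
        change LieSubmodule.Quotient.mk (N := idealOneCoboundary K 𝔯 M) ⁅(x : 𝔤), F φ⁆ = 0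
        rw [h0]
        rfl
  refine ⟨LinearEquiv.ofBijective G ⟨?_, ?_⟩⟩
  · rw [← LinearMap.ker_eq_bot, LinearMap.ker_eq_bot']
    intro φ hφ
    have h1 : F φ ∈ idealOneCoboundary K 𝔯 M :=
      (Submodule.Quotient.mk_eq_zero _).1 (congrArg Subtype.val hφ)
    obtain ⟨m, hm⟩ := (mem_oneCoboundary_iff _).1 h1
    have hm' : ∀ v : 𝔯, ι (φ v) = ⁅v, m⁆ := hm
    ext v
    have h2 : ι (φ v) = 0 := by
      rw [hm']
      refine hcobound m (fun x v => ?_) v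
      rw [← hm', ← hm', LieModuleHom.map_lie]
      exact ι.map_lie x (φ v)
    simpa using hι (h2.trans (map_zero ι).symm)
  · intro c
    obtain ⟨f, hf, hfx⟩ := exists_equivariant_representative c
    obtain ⟨φ, hφ⟩ := hfactor f.1 f.2 hfx
    refine ⟨φ, Subtype.ext ?_⟩
    rw [← hf]
    have : F φ = f := by
      apply Subtype.ext
      ext v
      exact (hφ v).symm
    rw [← this]
    rfl

end Invariants

/-- The `𝔰`-component of an `𝔰`-equivariant cocycle `f : 𝔯 → 𝔤` vanishes: its image is an ideal of
`𝔰`, and it is abelian because the bracket of the components of `f v` and `f u` is both symmetric and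
antisymmetric in `u`, `v`. -/
lemma equivariant_cocycle_mem [CharZero K] [LieAlgebra.HasTrivialRadical K 𝔰] [IsLieAbelian 𝔯]
    (h_levi : IsCompl 𝔰.toSubmodule 𝔯.toSubmodule)
    {f : 𝔯 →ₗ[K] 𝔤} (hf : f ∈ oneCocycle K 𝔯 𝔤) (hfx : ∀ (x : 𝔰) (v : 𝔯), f ⁅x, v⁆ = ⁅x, f v⁆)
    (v : 𝔯) : f v ∈ 𝔯 := by
  let p : 𝔤 →ₗ[K] 𝔰 := Submodule.projectionOnto _ _ h_levi
  let f₀ : 𝔯 →ₗ[K] 𝔰 := p ∘ₗ f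
  have hpr : ∀ x ∈ 𝔯, p x = 0 := fun x hx =>
    (Submodule.projectionOnto_apply_eq_zero_iff h_levi).2 hx
  have hps : ∀ x : 𝔰, p x = x := fun x => Submodule.projectionOnto_apply_left h_levi x
  have hdec : ∀ x, x - p x ∈ 𝔯 := fun x => by
    refine (Submodule.projectionOnto_apply_eq_zero_iff h_levi).1 ?_
    change p (x - p x) = 0
    rw [map_sub, hps, sub_self]
  have hab : ∀ u ∈ 𝔯, ∀ w ∈ 𝔯, ⁅u, w⁆ = 0 := fun u hu w hw =>
    congrArg Subtype.val (trivial_lie_zero 𝔯 𝔯 ⟨u, hu⟩ ⟨w, hw⟩)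
  have hequiv : ∀ (x : 𝔰) (v : 𝔯), f₀ ⁅x, v⁆ = ⁅x, f₀ v⁆ := fun x v => by
    have h1 : ⁅(x : 𝔤), f v⁆ = (⁅x, f₀ v⁆ : 𝔰) + ⁅(x : 𝔤), f v - f₀ v⁆ := by
      rw [LieSubalgebra.coe_bracket, ← lie_add, add_sub_cancel]
    change p (f ⁅x, v⁆) = _
    rw [hfx]
    change p ⁅(x : 𝔤), f v⁆ = _
    rw [h1, map_add, hps, hpr ⁅(x : 𝔤), f v - f₀ v⁆ (lie_mem_right K 𝔤 𝔯 _ _ (hdec (f v))), add_zero]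
  have hsymm : ∀ u v : 𝔯, ⁅f₀ v, u⁆ = ⁅f₀ u, v⁆ := fun u v => by
    have h1 := (mem_oneCocycle_iff f).1 hf u v
    rw [trivial_lie_zero, map_zero, eq_comm, sub_eq_zero] at h1
    have h2 : ∀ u v : 𝔯, ⁅(u : 𝔤), f v⁆ = ⁅(u : 𝔤), (f₀ v : 𝔤)⁆ := fun u v => by
      rw [← sub_eq_zero, ← lie_sub]
      exact hab _ u.2 _ (hdec _)
    apply Subtype.ext
    change ⁅(f₀ v : 𝔤), (u : 𝔤)⁆ = ⁅(f₀ u : 𝔤), (v : 𝔤)⁆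
    rw [← lie_skew (f₀ v : 𝔤), ← lie_skew (f₀ u : 𝔤), ← h2, ← h2]
    exact congrArg Neg.neg h1
  let I : LieIdeal K 𝔰 :=
    { LinearMap.range f₀ with
      lie_mem := by
        rintro x _ ⟨v, rfl⟩
        exact ⟨⁅x, v⁆, hequiv x v⟩ }
  have hI : IsLieAbelian I := by
    refine ⟨?_⟩
    rintro ⟨_, v, rfl⟩ ⟨_, u, rfl⟩
    apply Subtype.ext
    change ⁅f₀ v, f₀ u⁆ = 0
    have h1 : ⁅f₀ v, f₀ u⁆ = ⁅f₀ u, f₀ v⁆ := by rw [← hequiv, ← hequiv, hsymm]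
    rw [← lie_skew, neg_eq_iff_add_eq_zero, ← two_smul K] at h1
    rw [← lie_skew, (smul_eq_zero.1 h1).resolve_left two_ne_zero, neg_zero]
  have hbot : I = ⊥ :=
    (LieAlgebra.hasTrivialRadical_iff_no_abelian_ideals (R := K) (L := 𝔰)).1 inferInstance _ hI
  have h0 : f₀ v ∈ I := ⟨v, rfl⟩
  rw [hbot, LieSubmodule.mem_bot] at h0
  simpa [show p (f v) = 0 from h0] using hdec (f v)

/-- An `𝔰`-equivariant coboundary `v ↦ ⁅v, m⁆` vanishes: the class of the `𝔰`-component of `m` is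
central in the image of `𝔰` in `End 𝔯`, which is semisimple. -/
lemma equivariant_coboundary_eq_zero [CharZero K] [FiniteDimensional K 𝔰]
    [LieAlgebra.HasTrivialRadical K 𝔰] [IsLieAbelian 𝔯]
    (h_levi : IsCompl 𝔰.toSubmodule 𝔯.toSubmodule) (m : 𝔤)
    (hm : ∀ (x : 𝔰) (v : 𝔯), ⁅(⁅x, v⁆ : 𝔯), m⁆ = ⁅x, ⁅v, m⁆⁆) (v : 𝔯) : ⁅v, m⁆ = 0 := by
  have hab : ∀ u ∈ 𝔯, ∀ w ∈ 𝔯, ⁅u, w⁆ = 0 := fun u hu w hw =>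
    congrArg Subtype.val (trivial_lie_zero 𝔯 𝔯 ⟨u, hu⟩ ⟨w, hw⟩)
  obtain ⟨a, ha, b, hb, rfl⟩ := Submodule.mem_sup.1
    (h_levi.sup_eq_top ▸ Submodule.mem_top : m ∈ 𝔰.toSubmodule ⊔ 𝔯.toSubmodule)
  have hmem : ∀ c : 𝔰, c ∈ LieModule.ker K 𝔰 𝔯 ↔ ∀ w : 𝔯, ⁅(w : 𝔤), (c : 𝔤)⁆ = 0 := fun c => by
    rw [LieModule.mem_ker]
    refine forall_congr' fun w => ?_
    rw [← lie_skew, neg_eq_zero, Subtype.ext_iff]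
    rfl
  have hker : ∀ x : 𝔰, ⁅x, (⟨a, ha⟩ : 𝔰)⁆ ∈ LieModule.ker K 𝔰 𝔯 := fun x => by
    refine (hmem _).2 fun w => ?_
    have h1 : ⁅⁅(x : 𝔤), (w : 𝔤)⁆, a + b⁆ = ⁅(x : 𝔤), ⁅(w : 𝔤), a + b⁆⁆ := hm x w
    rw [lie_add, lie_add, hab _ (lie_mem_right K 𝔤 𝔯 _ _ w.2) _ hb, hab _ w.2 _ hb, add_zero,
      add_zero, leibniz_lie (x : 𝔤) (w : 𝔤) a, left_eq_add] at h1
    exact h1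
  obtain ⟨n, hn, hc⟩ := exists_mem_forall_lie_sub_eq_zero (LieModule.ker K 𝔰 𝔯) _ hker
  have hcenter : (⟨a, ha⟩ - n : 𝔰) ∈ LieAlgebra.center K 𝔰 :=
    (mem_maxTrivSubmodule K 𝔰 𝔰 _).2 hc
  rw [LieAlgebra.center_eq_bot, LieSubmodule.mem_bot, sub_eq_zero] at hcenter
  rw [← hcenter] at hn
  change ⁅(v : 𝔤), a + b⁆ = 0
  rw [lie_add, hab _ v.2 _ hb, add_zero]
  exact (hmem _).1 hn v

section Extension

variable [IsLieAbelian 𝔯] (h_levi : IsCompl 𝔰.toSubmodule 𝔯.toSubmodule)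

/-- The extension by zero on `𝔰` of an `𝔰`-endomorphism of the abelian ideal `𝔯`, a `1`-cocycle (that
is, a derivation) of `𝔤 = 𝔰 ⋉ 𝔯`. -/
noncomputable def extendByZero : (𝔯 →ₗ⁅K,𝔰⁆ 𝔯) →ₗ[K] oneCocycle K 𝔤 𝔤 where
  toFun φ := ⟨𝔯.toSubmodule.subtype ∘ₗ (φ : 𝔯 →ₗ[K] 𝔯) ∘ₗ
      Submodule.projectionOnto _ _ h_levi.symm, by
    have hab : ∀ u v : 𝔯, ⁅(u : 𝔤), (v : 𝔤)⁆ = 0 := fun u v =>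
      congrArg Subtype.val (trivial_lie_zero 𝔯 𝔯 u v)
    set q : 𝔤 →ₗ[K] 𝔯 := Submodule.projectionOnto _ _ h_levi.symm
    have hqs : ∀ x : 𝔰, q x = 0 := fun x =>
      (Submodule.projectionOnto_apply_eq_zero_iff h_levi.symm).2 x.2
    have hqr : ∀ v : 𝔯, q v = v := fun v =>
      Submodule.projectionOnto_apply_left h_levi.symm v
    refine (mem_oneCocycle_iff _).2 fun x y => ?_
    obtain ⟨a, ha, u, hu, rfl⟩ := Submodule.mem_sup.1
      (h_levi.sup_eq_top ▸ Submodule.mem_top : x ∈ 𝔰.toSubmodule ⊔ 𝔯.toSubmodule)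
    obtain ⟨b, hb, v, hv, rfl⟩ := Submodule.mem_sup.1
      (h_levi.sup_eq_top ▸ Submodule.mem_top : y ∈ 𝔰.toSubmodule ⊔ 𝔯.toSubmodule)
    lift a to 𝔰 using ha
    lift b to 𝔰 using hb
    lift u to 𝔯 using hu
    lift v to 𝔯 using hv
    have hbr : ⁅(a : 𝔤) + u, (b : 𝔤) + v⁆ =
        ((⁅a, b⁆ : 𝔰) : 𝔤) + ((⁅a, v⁆ - ⁅b, u⁆ : 𝔯) : 𝔤) := by
      change _ = ⁅(a : 𝔤), (b : 𝔤)⁆ + (⁅(a : 𝔤), (v : 𝔤)⁆ - ⁅(b : 𝔤), (u : 𝔤)⁆)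
      rw [lie_add, add_lie, add_lie, hab, ← lie_skew (b : 𝔤) (u : 𝔤)]
      abel
    change ((φ (q _) : 𝔯) : 𝔤) = ⁅(a : 𝔤) + u, ((φ (q _) : 𝔯) : 𝔤)⁆ -
      ⁅(b : 𝔤) + v, ((φ (q _) : 𝔯) : 𝔤)⁆
    rw [hbr]
    simp only [map_add, hqs, hqr, zero_add, map_sub, LieModuleHom.map_lie, add_lie, hab, add_zero]
    rfl⟩
  map_add' φ ψ := rfl
  map_smul' c φ := rfl

lemma extendByZero_apply_left (φ : 𝔯 →ₗ⁅K,𝔰⁆ 𝔯) (x : 𝔰) :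
    (extendByZero h_levi φ).1 x = 0 := by
  change ((φ (Submodule.projectionOnto _ _ h_levi.symm (x : 𝔤)) : 𝔯) : 𝔤) = 0
  rw [(Submodule.projectionOnto_apply_eq_zero_iff h_levi.symm).2 x.2, map_zero]
  rfl

lemma extendByZero_apply_right (φ : 𝔯 →ₗ⁅K,𝔰⁆ 𝔯) (v : 𝔯) :
    (extendByZero h_levi φ).1 v = φ v := by
  change ((φ (Submodule.projectionOnto _ _ h_levi.symm (v : 𝔤)) : 𝔯) : 𝔤) = φ v
  rw [show Submodule.projectionOnto _ _ h_levi.symm (v : 𝔤) = v from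
    Submodule.projectionOnto_apply_left h_levi.symm v]

/-- The map `End_𝔰(𝔯) → H¹(𝔤, 𝔤)` given by extension by zero. -/
noncomputable def endToH1 : (𝔯 →ₗ⁅K,𝔰⁆ 𝔯) →ₗ[K] H1 K 𝔤 𝔤 :=
  Submodule.mkQ _ ∘ₗ extendByZero h_levi

variable [CharZero K] [LieAlgebra.HasTrivialRadical K 𝔰]

lemma endToH1_injective [FiniteDimensional K 𝔰] : Function.Injective (endToH1 h_levi) := by
  rw [← LinearMap.ker_eq_bot, LinearMap.ker_eq_bot']
  intro φ hφ
  have h1 : extendByZero h_levi φ ∈ (oneCoboundary K 𝔤 𝔤).submoduleOf (oneCocycle K 𝔤 𝔤) :=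
    (Submodule.Quotient.mk_eq_zero _).1 hφ
  obtain ⟨m, hm⟩ := (mem_oneCoboundary_iff _).1 h1
  have hm' : ∀ v : 𝔯, (φ v : 𝔤) = ⁅v, m⁆ := fun v => by
    rw [← extendByZero_apply_right h_levi]
    exact hm v
  ext v
  rw [hm']
  refine equivariant_coboundary_eq_zero h_levi m (fun x v => ?_) v
  rw [← hm', ← hm', LieModuleHom.map_lie]
  rfl

/-- By Whitehead's first lemma a cocycle of `𝔤` is cohomologous to one vanishing on `𝔰`, whose
restriction to `𝔯` is `𝔰`-equivariant. -/
lemma endToH1_surjective [FiniteDimensional K 𝔤] : Function.Surjective (endToH1 h_levi) := by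
  intro c
  obtain ⟨f, rfl⟩ := Submodule.mkQ_surjective _ c
  have hf := (mem_oneCocycle_iff f.1).1 f.2
  obtain ⟨m, hm⟩ := (mem_oneCoboundary_iff _).1 <| oneCocycle_le_oneCoboundary (L := 𝔰) (M := 𝔤)
    ((mem_oneCocycle_iff (L := 𝔰) (f.1 ∘ₗ 𝔰.toSubmodule.subtype)).2 fun x y => hf x y)
  have hm' : ∀ x : 𝔰, f.1 x = ⁅(x : 𝔤), m⁆ := hm
  let g : 𝔤 →ₗ[K] 𝔤 := f.1 - d01 K 𝔤 𝔤 m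
  have hg : g ∈ oneCocycle K 𝔤 𝔤 :=
    sub_mem f.2 (oneCoboundary_le_oneCocycle K 𝔤 𝔤 ⟨m, rfl⟩)
  have hg' := (mem_oneCocycle_iff g).1 hg
  have hgs : ∀ x : 𝔰, g x = 0 := fun x => sub_eq_zero.2 (hm' x)
  have hgx : ∀ (x : 𝔰) (v : 𝔯), g ⁅(x : 𝔤), (v : 𝔤)⁆ = ⁅(x : 𝔤), g v⁆ := fun x v => by
    rw [hg', hgs, lie_zero, sub_zero]
  have hgr : ∀ v : 𝔯, g v ∈ 𝔯 :=
    equivariant_cocycle_mem h_levi (f := g ∘ₗ 𝔯.toSubmodule.subtype)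
      ((mem_oneCocycle_iff _).2 fun u v => hg' u v) hgx
  let φ : 𝔯 →ₗ⁅K,𝔰⁆ 𝔯 :=
    { LinearMap.codRestrict 𝔯.toSubmodule (g ∘ₗ 𝔯.toSubmodule.subtype) hgr with
      map_lie' := fun {x v} => Subtype.ext (hgx x v) }
  refine ⟨φ, (Submodule.Quotient.eq _).2 ?_⟩
  refine (mem_oneCoboundary_iff _).2 ⟨-m, fun x => ?_⟩
  change (extendByZero h_levi φ).1 x - f.1 x = ⁅x, -m⁆
  have hx : (extendByZero h_levi φ).1 x = g x := by
    obtain ⟨a, ha, u, hu, rfl⟩ := Submodule.mem_sup.1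
      (h_levi.sup_eq_top ▸ Submodule.mem_top : x ∈ 𝔰.toSubmodule ⊔ 𝔯.toSubmodule)
    rw [map_add, map_add, extendByZero_apply_left h_levi φ ⟨a, ha⟩, hgs ⟨a, ha⟩,
      extendByZero_apply_right h_levi φ ⟨u, hu⟩]
    rfl
  rw [hx, lie_neg]
  change f.1 x - ⁅x, m⁆ - f.1 x = _
  abel

end Extension

/-- A cocycle `𝔤 → 𝔤` is a derivation, and a coboundary an inner one. -/
lemma IsComplete.subsingleton_H1 (h : IsComplete K 𝔤) : Subsingleton (H1 K 𝔤 𝔤) := by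
  suffices hle : oneCocycle K 𝔤 𝔤 ≤ oneCoboundary K 𝔤 𝔤 from
    (Submodule.Quotient.subsingleton_iff ..).2 (Submodule.submoduleOf_eq_top.2 hle)
  intro f hf
  obtain ⟨x, hx⟩ := h.2 ⟨f, (mem_oneCocycle_iff f).1 hf⟩
  refine (mem_oneCoboundary_iff f).2 ⟨-x, fun y => ?_⟩
  have h1 : f y = ⁅x, y⁆ := by
    have := congrArg (fun D : LieDerivation K 𝔤 𝔤 => D y) hx
    simpa using this
  rw [h1, lie_neg, lie_skew]

end LeviDecomposition

end LieCoh

/-- `𝔤 = 𝔰 ⋉ 𝔯` is a Levi decomposition: `𝔯` is the solvable radical of `𝔤` and `𝔰` is a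
semisimple subalgebra which is a vector space complement of `𝔯`. -/
theorem proposition3p8 {𝔤 : Type*} [LieRing 𝔤] [LieAlgebra ℂ 𝔤] [FiniteDimensional ℂ 𝔤]
    (𝔰 : LieSubalgebra ℂ 𝔤) (𝔯 : LieIdeal ℂ 𝔤)
    (h_rad : 𝔯 = LieAlgebra.radical ℂ 𝔤)
    (h_ss : LieAlgebra.IsSemisimple ℂ 𝔰)
    (h_levi : IsCompl 𝔰.toSubmodule 𝔯.toSubmodule)
    (h_ne : 𝔯 ≠ ⊥)
    (h_ab : IsLieAbelian 𝔯) :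
    (Nontrivial (LieCoh.H1 ℂ 𝔤 𝔤) ∧ ¬ LieCoh.IsComplete ℂ 𝔤) ∧
    ((∀ N N' : LieSubmodule ℂ 𝔰 𝔯, IsCompl N N' →
        ∀ J : LieIdeal ℂ 𝔰, J ≠ ⊥ → J ≠ ⊤ → IsEmpty (N ≃ₗ⁅ℂ, 𝔰⁆ J)) →
      Nonempty (LieCoh.idealH1Invariants ℂ 𝔯 𝔯 𝔰 ≃ₗ[ℂ] LieCoh.idealH1Invariants ℂ 𝔯 𝔤 𝔰) ∧
      Nonempty (LieCoh.idealH1Invariants ℂ 𝔯 𝔤 𝔰 ≃ₗ[ℂ] LieCoh.H1 ℂ 𝔤 𝔤)) := by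
  have hinj := LieCoh.endToH1_injective h_levi
  have hnt : Nontrivial (LieCoh.H1 ℂ 𝔤 𝔤) := by
    obtain ⟨v, hv, hv0⟩ := 𝔯.toSubmodule.ne_bot_iff.1 (by simpa using h_ne)
    have hid : (1 : 𝔯 →ₗ⁅ℂ, 𝔰⁆ 𝔯) ≠ 0 := fun h =>
      hv0 (congrArg Subtype.val (LieModuleHom.congr_fun h ⟨v, hv⟩))
    exact ⟨_, _, hinj.ne hid⟩
  refine ⟨⟨hnt, fun h => ?_⟩, fun _ => ?_⟩
  · exact not_subsingleton_iff_nontrivial.2 hnt h.subsingleton_H1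
  obtain ⟨eC⟩ : Nonempty ((𝔯 →ₗ⁅ℂ, 𝔰⁆ 𝔯) ≃ₗ[ℂ] LieCoh.H1 ℂ 𝔤 𝔤) :=
    ⟨LinearEquiv.ofBijective _ ⟨hinj, LieCoh.endToH1_surjective h_levi⟩⟩
  -- On `𝔯` the ideal `𝔯` acts trivially: every linear map is a cocycle, and coboundaries vanish.
  obtain ⟨eA⟩ := LieCoh.nonempty_equiv_idealH1Invariants (𝔰 := 𝔰) (LieModuleHom.id : 𝔯 →ₗ⁅ℂ, 𝔤⁆ 𝔯)
    Function.injective_id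
    (fun f _ hfx => ⟨{ f with map_lie' := fun {x v} => hfx x v }, fun _ => rfl⟩)
    (fun m _ v => LieModule.IsTrivial.trivial v m)
  obtain ⟨eB⟩ := LieCoh.nonempty_equiv_idealH1Invariants (𝔰 := 𝔰) (LieSubmodule.incl 𝔯)
    (LieSubmodule.injective_incl 𝔯)
    (fun f hf hfx => ⟨{ LinearMap.codRestrict 𝔯.toSubmodule f
        (LieCoh.equivariant_cocycle_mem h_levi hf hfx) with
      map_lie' := fun {x v} => Subtype.ext (hfx x v) }, fun _ => rfl⟩)
    (LieCoh.equivariant_coboundary_eq_zero h_levi)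
  exact ⟨⟨eA.symm.trans eB⟩, ⟨eB.symm.trans eC⟩⟩
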